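/- Let $\mathbb{D}$ be the open unit disk and let $D\subsetneq\mathbb{C}$ be a simply connected domain. Its hyperbolic density $\lambda_D$ is determined by $\lambda_D(\varphi(w))\,|\varphi'(w)|=1/(1-|w|^2)$, $w\in\mathbb{D}$, where $\varphi$ is a conformal mapping of $\mathbb{D}$ onto $D$. A harmonic mapping $f=h+\overline{g}$ in $D$ (with $h,g$ analytic in $D$) is sense-preserving if its Jacobian $J_f=|h'|^2-|g'|^2$ is positive in $D$; its pre-Schwarzian derivative is $P_f=\partial_z(\log J_f)$. For a locally univalent analytic function $F$ in $D$, put $P_F=F''/F'$. In both cases let $\|P\|_D=\sup_{z\in D}\lambda_D(z)^{-1}|P(z)|\in[0,\infty]$. (a) For every sense-preserving harmonic mapping $f=h+\overline{g}$ in $D$ and every $\varepsilon\in\overline{\mathbb{D}}$, the function $h+\varepsilon g$ is locally univalent in $D$ and $$\lambda_D(z)^{-1}\,|P_{h+\varepsilon g}(z)-P_f(z)|\le 1,\qquad z\in D.$$ Moreover, in $[0,\infty]$, $$\max\Bigl\{0,\ \sup_{\varepsilon\in\overline{\mathbb{D}}}\|P_{h+\varepsilon g}\|_D-1\Bigr\}\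 \le\ \|P_f\|_D\ \le\ \min_{\varepsilon\in\overline{\mathbb{D}}}\|P_{h+\varepsilon g}\|_D+1,$$ where the minimum is attained. (b) The constant $1$ is sharp in both estimates. For every simply connected domain $D\subsetneq\mathbb{C}$ and every $z\in D$ there are a sense-preserving harmonic mapping $f=h+\overline{g}$ in $D$ and an $\varepsilon\in\overline{\mathbb{D}}$ with $\lambda_D(z)^{-1}|P_{h+\varepsilon g}(z)-P_f(z)|=1$. For every open disk $D$ there is a sense-preserving harmonic mapping $f=h+\overline{g}$ in $D$ with $\|P_f\|_D<\infty$ for which both inequalities of the second estimate are equalities. -/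

import Mathlib

open Set Metric Complex
open scoped ENNReal ComplexConjugate

noncomputable section

/-- `φ` is a conformal mapping of the open unit disk onto `D`. -/
structure IsConformalDiskMap (φ : ℂ → ℂ) (D : Set ℂ) : Prop where
  differentiableOn : DifferentiableOn ℂ φ (ball 0 1)
  deriv_ne_zero : ∀ w ∈ ball (0 : ℂ) 1, deriv φ w ≠ 0
  bijOn : BijOn φ (ball 0 1) D

/-- `ρ` is the value at `z` of the metric on `D` induced, through a conformal mapping `φ` of the
unit disk onto `D`, by the metric `1 / (1 - |w| ^ 2)` of the unit disk. -/
def IsInducedDensity (D : Set ℂ) (z : ℂ) (ρ : ℝ) : Prop :=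
  ∃ φ : ℂ → ℂ, IsConformalDiskMap φ D ∧
    ∃ w ∈ ball (0 : ℂ) 1, φ w = z ∧ ρ * ‖deriv φ w‖ = 1 / (1 - ‖w‖ ^ 2)

open Classical in
/-- The density `λ_D(z)` of the hyperbolic metric (of curvature `-4`) of a simply connected domain
`D ≠ ℂ`, determined by `λ_D(φ(w)) |φ'(w)| = 1 / (1 - |w| ^ 2)` where `φ` is a conformal mapping of
the unit disk onto `D`; it does not depend on the choice of `φ`. -/
def hyperbolicDensity (D : Set ℂ) (z : ℂ) : ℝ :=
  if h : ∃ ρ : ℝ, IsInducedDensity D z ρ then h.choose else 0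

/-- The Jacobian determinant `J_f(z)` of `f : ℂ → ℂ` as a real mapping of the plane. -/
def jacobian (f : ℂ → ℂ) (z : ℂ) : ℝ := (fderiv ℝ f z).det

/-- The Wirtinger derivative `∂u/∂z = (u_x - i u_y) / 2`. -/
def wirtingerDeriv (u : ℂ → ℂ) (z : ℂ) : ℂ :=
  (fderiv ℝ u z 1 - I * fderiv ℝ u z I) / 2

/-- `f` is a sense-preserving (complex-valued) harmonic mapping in `D`. -/
def IsSensePreservingHarmonic (f : ℂ → ℂ) (D : Set ℂ) : Prop :=
  InnerProductSpace.HarmonicOnNhd f D ∧ ∀ z ∈ D, 0 < jacobian f z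

/-- `f = h + conj g` in `D`, with `h` and `g` analytic in `D`. -/
structure IsAnalyticDecomposition (f h g : ℂ → ℂ) (D : Set ℂ) : Prop where
  left : DifferentiableOn ℂ h D
  right : DifferentiableOn ℂ g D
  eqOn : EqOn f (fun z => h z + conj (g z)) D

/-- The pre-Schwarzian derivative `F'' / F'` of a locally univalent analytic function. -/
def preSchwarzian (F : ℂ → ℂ) (z : ℂ) : ℂ := deriv (deriv F) z / deriv F z

/-- The harmonic pre-Schwarzian derivative `P_f = (log J_f)_z`. -/
def harmonicPreSchwarzian (f : ℂ → ℂ) (z : ℂ) : ℂ :=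
  wirtingerDeriv (fun w => (Real.log (jacobian f w) : ℂ)) z

/-- The norm `‖P‖_D = sup_{z ∈ D} λ_D(z)⁻¹ |P(z)|`, with values in `[0, ∞]`. -/
def hyperbolicNorm (D : Set ℂ) (P : ℂ → ℂ) : ℝ≥0∞ :=
  ⨆ z ∈ D, ENNReal.ofReal ((hyperbolicDensity D z)⁻¹ * ‖P z‖)

/-- The analytic function `h + ε g`. -/
def shear (h g : ℂ → ℂ) (ε : ℂ) : ℂ → ℂ := fun z => h z + ε * g z

end

/-!
Write `ω = g' / h'` for the dilatation of `f = h + conj g`, a holomorphic map of `D` into the unit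
disk. The Jacobian is `|h'|² - |g'|²`, and a direct computation gives
`P_{h + ε g} - P_f = ω' (ε + conj ω) / ((1 + ε ω) (1 - |ω|²))`. For `|ε| ≤ 1` one has
`|ε + conj ω| ≤ |1 + ε ω|`, with equality if `|ε| = 1`, so that the pointwise estimate is the
Schwarz–Pick inequality `|ω'| ≤ λ_D (1 - |ω|²)` (`norm_deriv_le_hyperbolicDensity_mul`). It implies
the estimates for the norms, and the minimum over `ε` is attained because the norm of `P_{h + ε g}`
is a supremum of continuous functions of `ε`.

For the sharpness at a point of an arbitrary domain, `f` is chosen such that its dilatation is a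
conformal mapping `ψ` of `D` onto the disk, for which Schwarz–Pick is an equality: `h = ψ` and
`g = ψ² / 2`. This rests on the Riemann mapping theorem (`exists_isConformalDiskMap`), which is
proved here by maximizing `|F' z₀|` among the conformal mappings `F` of `D` into the disk: the
extremal function exists by Montel's and Hurwitz's theorems, and it is onto the disk by Koebe's
square-root transform.

For the sharpness in a disk, let `u` be the affine map of the disk onto the unit disk, and choose
`h = -log (1 - u)` and `g = h - u`. Then `h - g = u` has vanishing pre-Schwarzian, so that the
infimum is `0` and `‖P_f‖ ≤ 1`, whereas `P_{h + g}` has hyperbolic norm at least `2` already at the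
centre, so that `1 ≤ ‖P_f‖`.
-/

namespace HarmonicMapping

open Filter Topology

/-! ### Disk automorphisms and the Schwarz–Pick inequality -/

/-- The automorphism `z ↦ (z - a) / (1 - conj a * z)` of the unit disk that sends `a` to `0`. -/
noncomputable def diskAut (a z : ℂ) : ℂ := (z - a) / (1 - conj a * z)

lemma one_sub_conj_mul_ne_zero {a z : ℂ} (ha : ‖a‖ < 1) (hz : ‖z‖ < 1) :
    1 - conj a * z ≠ 0 := by
  intro h
  have h1 : ‖conj a * z‖ = 1 := by rw [← sub_eq_zero.mp h, norm_one]
  rw [norm_mul, RCLike.norm_conj] at h1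
  nlinarith [norm_nonneg a, norm_nonneg z]

lemma normSq_one_sub_conj_mul_sub_normSq_sub (a z : ℂ) :
    normSq (1 - conj a * z) - normSq (z - a) = (1 - normSq a) * (1 - normSq z) := by
  simp only [normSq_apply, sub_re, sub_im, mul_re, mul_im, conj_re, conj_im, one_re, one_im]
  ring

lemma norm_diskAut_lt_one {a z : ℂ} (ha : ‖a‖ < 1) (hz : ‖z‖ < 1) : ‖diskAut a z‖ < 1 := by
  have h0 := one_sub_conj_mul_ne_zero ha hz
  have h := normSq_one_sub_conj_mul_sub_normSq_sub a z
  simp only [normSq_eq_norm_sq] at h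
  rw [diskAut, norm_div, div_lt_one (norm_pos_iff.mpr h0)]
  refine lt_of_pow_lt_pow_left₀ 2 (norm_nonneg _) ?_
  have : 0 < (1 - ‖a‖ ^ 2) * (1 - ‖z‖ ^ 2) := by
    apply mul_pos <;> nlinarith [norm_nonneg a, norm_nonneg z]
  linarith

lemma diskAut_self (a : ℂ) : diskAut a a = 0 := by simp [diskAut]

lemma diskAut_zero (a : ℂ) : diskAut a 0 = -a := by simp [diskAut]

lemma diskAut_injOn {a : ℂ} (ha : ‖a‖ < 1) : InjOn (diskAut a) (ball 0 1) := by
  intro z hz w hw h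
  rw [mem_ball_zero_iff] at hz hw
  have hz' := one_sub_conj_mul_ne_zero ha hz
  have hw' := one_sub_conj_mul_ne_zero ha hw
  rw [diskAut, diskAut, div_eq_div_iff hz' hw'] at h
  have h1 : (1 - conj a * a) * (z - w) = 0 := by linear_combination h
  exact sub_eq_zero.mp ((mul_eq_zero.mp h1).resolve_left (one_sub_conj_mul_ne_zero ha ha))

lemma hasDerivAt_diskAut {a z : ℂ} (ha : ‖a‖ < 1) (hz : ‖z‖ < 1) :
    HasDerivAt (diskAut a) ((1 - conj a * a) / (1 - conj a * z) ^ 2) z := by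
  have h0 := one_sub_conj_mul_ne_zero ha hz
  have h1 : HasDerivAt (fun z => 1 - conj a * z) (-conj a) z := by
    simpa using ((hasDerivAt_id z).const_mul (conj a)).const_sub 1
  have h2 := ((hasDerivAt_id z).sub_const a).div h1 h0
  refine h2.congr_deriv ?_
  simp only [id_eq]
  ring

lemma norm_one_sub_conj_mul_self {a : ℂ} (ha : ‖a‖ < 1) :
    ‖1 - conj a * a‖ = 1 - ‖a‖ ^ 2 := by
  have : 1 - conj a * a = ((1 - ‖a‖ ^ 2 : ℝ) : ℂ) := by
    rw [conj_mul']; push_cast; rfl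
  rw [this, norm_real, Real.norm_of_nonneg]
  nlinarith [norm_nonneg a]

/-- Post-composing with the automorphism that sends `F z` to `0` divides the derivative at `z`
by `1 - ‖F z‖ ^ 2`, in absolute value. -/
lemma norm_deriv_diskAut_comp_self {F : ℂ → ℂ} {z : ℂ} (hF : DifferentiableAt ℂ F z)
    (hz : ‖F z‖ < 1) :
    ‖deriv (fun x => diskAut (F z) (F x)) z‖ = ‖deriv F z‖ / (1 - ‖F z‖ ^ 2) := by
  have h := (hasDerivAt_diskAut hz hz).comp z hF.hasDerivAt
  have h1 : 1 - ‖F z‖ ^ 2 ≠ 0 := by nlinarith [norm_nonneg (F z)]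
  rw [show (fun x => diskAut (F z) (F x)) = diskAut (F z) ∘ F from rfl, h.deriv, norm_mul,
    norm_div, norm_pow, norm_one_sub_conj_mul_self hz]
  field_simp

/-- The **Schwarz–Pick inequality** at the centre of a disk. -/
lemma norm_deriv_center_le {F : ℂ → ℂ} {c : ℂ} {r : ℝ} (hr : 0 < r)
    (hF : DifferentiableOn ℂ F (ball c r)) (hmaps : MapsTo F (ball c r) (ball 0 1)) :
    r * ‖deriv F c‖ ≤ 1 - ‖F c‖ ^ 2 := by
  have hc : c ∈ ball c r := mem_ball_self hr
  have hlt : ∀ z ∈ ball c r, ‖F z‖ < 1 := fun z hz => mem_ball_zero_iff.mp (hmaps hz)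
  have hd : DifferentiableOn ℂ (fun x => diskAut (F c) (F x)) (ball c r) := fun z hz =>
    (hasDerivAt_diskAut (hlt c hc) (hlt z hz)).differentiableAt.comp_differentiableWithinAt z
      (hF z hz)
  have h := norm_deriv_le_div_of_mapsTo_ball (R₂ := 1) hd (fun z hz => by
    simpa [diskAut_self] using (norm_diskAut_lt_one (hlt c hc) (hlt z hz)).le) hr
  rw [norm_deriv_diskAut_comp_self (hF.differentiableAt (isOpen_ball.mem_nhds hc)) (hlt c hc),
    div_le_div_iff₀ (by nlinarith [norm_nonneg (F c), hlt c hc]) hr] at h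
  linarith

/-- The **Schwarz–Pick inequality** in the unit disk. -/
lemma norm_deriv_le_of_mapsTo_unitBall {F : ℂ → ℂ} (hF : DifferentiableOn ℂ F (ball 0 1))
    (hmaps : MapsTo F (ball 0 1) (ball 0 1)) {w : ℂ} (hw : ‖w‖ < 1) :
    (1 - ‖w‖ ^ 2) * ‖deriv F w‖ ≤ 1 - ‖F w‖ ^ 2 := by
  have hw' : ‖-w‖ < 1 := by rwa [norm_neg]
  have hT : ∀ z ∈ ball (0 : ℂ) 1, diskAut (-w) z ∈ ball (0 : ℂ) 1 := fun z hz =>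
    mem_ball_zero_iff.mpr (norm_diskAut_lt_one hw' (mem_ball_zero_iff.mp hz))
  have hd : DifferentiableOn ℂ (F ∘ diskAut (-w)) (ball 0 1) := hF.comp (fun z hz =>
    (hasDerivAt_diskAut hw' (mem_ball_zero_iff.mp hz)).differentiableAt.differentiableWithinAt) hT
  have h := norm_deriv_center_le one_pos hd (hmaps.comp hT)
  have h0 : diskAut (-w) 0 = w := by rw [diskAut_zero, neg_neg]
  have hFw : HasDerivAt F (deriv F w) (diskAut (-w) 0) := by
    rw [h0]
    exact (hF.differentiableAt (isOpen_ball.mem_nhds (mem_ball_zero_iff.mpr hw))).hasDerivAt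
  rw [(hFw.comp 0 (hasDerivAt_diskAut hw' (by simp))).deriv, Function.comp_apply, h0, norm_mul,
    norm_div, norm_one_sub_conj_mul_self hw'] at h
  simp only [norm_neg, mul_zero, sub_zero, one_pow, norm_one, div_one, one_mul] at h
  linarith

/-! ### Inverses of locally univalent functions -/

lemma hasStrictDerivAt_of_differentiableOn {U : Set ℂ} (hU : IsOpen U) {f : ℂ → ℂ}
    (hf : DifferentiableOn ℂ f U) {z : ℂ} (hz : z ∈ U) : HasStrictDerivAt f (deriv f z) z :=
  (hf.analyticAt (hU.mem_nhds hz)).hasStrictDerivAt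

/-- A left inverse `g` of `f` on `U` need not be assumed continuous: `f` maps neighbourhoods of `z`
onto neighbourhoods of `f z`, so that `g` is determined near `f z`. -/
lemma hasStrictDerivAt_leftInverse {U : Set ℂ} (hU : IsOpen U) {f g : ℂ → ℂ}
    (hf : DifferentiableOn ℂ f U) (hg : LeftInvOn g f U) {z : ℂ} (hz : z ∈ U)
    (hf' : deriv f z ≠ 0) : HasStrictDerivAt g (deriv f z)⁻¹ (f z) := by
  have hs := hasStrictDerivAt_of_differentiableOn hU hf hz
  have hmap : map f (𝓝 z) = 𝓝 (f z) := hs.map_nhds_eq hf'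
  have hev : ∀ᶠ x in 𝓝 z, g (f x) = x := by
    filter_upwards [hU.mem_nhds hz] with x hx using hg hx
  have hgz : g (f z) = z := hg hz
  apply HasStrictDerivAt.of_local_left_inverse (f := f)
  · rw [ContinuousAt, hgz, ← hmap, tendsto_map'_iff]
    exact tendsto_id.congr' (hev.mono fun x hx => hx.symm)
  · rwa [hgz]
  · exact hf'
  · rw [← hmap, eventually_map]
    exact hev.mono fun x hx => by rw [hx]

/-! ### Normal families and Hurwitz's theorem -/

/-- **Montel's theorem** along an ultrafilter: holomorphic maps into the unit disk converge locally
uniformly, because pointwise limits exist by compactness of the closed disk and the Schwarz lemma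
makes the maps locally equi-Lipschitz. -/
lemma exists_tendstoLocallyUniformlyOn {ι : Type*} (l : Ultrafilter ι) {U : Set ℂ} (hU : IsOpen U)
    {f : ι → ℂ → ℂ} (hf : ∀ n, DifferentiableOn ℂ (f n) U)
    (hmaps : ∀ n, MapsTo (f n) U (ball 0 1)) :
    ∃ F : ℂ → ℂ, TendstoLocallyUniformlyOn f F l U := by
  have hlim : ∀ z : ℂ, ∃ y : ℂ, z ∈ U → Tendsto (fun n => f n z) l (𝓝 y) := by
    intro z
    by_cases hz : z ∈ U
    · obtain ⟨y, -, hy⟩ := (isCompact_closedBall (0 : ℂ) 1).ultrafilter_le_nhds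
        (l.map fun n => f n z) (by
          rw [le_principal_iff]
          exact mem_map.mpr (univ_mem' fun n => ball_subset_closedBall (hmaps n hz)))
      exact ⟨y, fun _ => hy⟩
    · exact ⟨0, fun h => absurd h hz⟩
  choose F hF using hlim
  refine ⟨F, ?_⟩
  rw [Metric.tendstoLocallyUniformlyOn_iff]
  intro ε hε z hz
  obtain ⟨r, hr, hrU⟩ := Metric.isOpen_iff.mp hU z hz
  have hlip : ∀ n, ∀ x ∈ ball z r, dist (f n x) (f n z) ≤ 2 / r * dist x z := fun n x hx =>
    dist_le_div_mul_dist_of_mapsTo_ball ((hf n).mono hrU) (fun y hy => by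
      have h1 := mem_ball_zero_iff.mp (hmaps n (hrU hy))
      have h2 := mem_ball_zero_iff.mp (hmaps n hz)
      rw [mem_closedBall, dist_eq_norm]
      linarith [norm_sub_le (f n y) (f n z)]) hx
  have hlipF : ∀ x ∈ ball z r, dist (F x) (F z) ≤ 2 / r * dist x z := fun x hx =>
    le_of_tendsto ((hF x (hrU hx)).dist (hF z hz)) (Eventually.of_forall fun n => hlip n x hx)
  set δ := min r (r * ε / 8) with hδ
  have hδ0 : 0 < δ := by positivity
  refine ⟨ball z δ, mem_nhdsWithin_of_mem_nhds (ball_mem_nhds z hδ0), ?_⟩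
  filter_upwards [Metric.tendsto_nhds.mp (hF z hz) (ε / 4) (by positivity)] with n hn x hx
  have hxr : x ∈ ball z r := ball_subset_ball (min_le_left _ _) hx
  have hx2 : 2 / r * dist x z ≤ ε / 4 := by
    have h1 : dist x z ≤ r * ε / 8 := (mem_ball.mp hx).le.trans (min_le_right _ _)
    calc 2 / r * dist x z ≤ 2 / r * (r * ε / 8) := by gcongr
      _ = ε / 4 := by field_simp; norm_num
  calc dist (F x) (f n x) ≤ dist (F x) (F z) + dist (F z) (f n z) + dist (f n z) (f n x) :=
        dist_triangle4 _ _ _ _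
    _ ≤ ε / 4 + ε / 4 + ε / 4 := by
        gcongr
        · exact (hlipF x hxr).trans hx2
        · rw [dist_comm]; exact hn.le
        · rw [dist_comm]; exact (hlip n x hxr).trans hx2
    _ < ε := by linarith

/-- **Hurwitz's theorem**, local form: if zero-free holomorphic functions converge locally uniformly
to `F` and `F` does not vanish identically near `b`, then `F b ≠ 0`. The proof applies the maximum
principle to the reciprocals on a small circle around `b`. -/
lemma ne_zero_of_tendstoLocallyUniformlyOn {ι : Type*} {l : Filter ι} [l.NeBot] {V : Set ℂ}
    (hV : IsOpen V) {f : ι → ℂ → ℂ} {F : ℂ → ℂ} (hf : ∀ n, DifferentiableOn ℂ (f n) V)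
    (hlim : TendstoLocallyUniformlyOn f F l V) (hne : ∀ n, ∀ z ∈ V, f n z ≠ 0) {b : ℂ}
    (hb : b ∈ V) (hF : ¬ ∀ᶠ z in 𝓝 b, F z = 0) : F b ≠ 0 := by
  intro hFb
  have hFd : DifferentiableOn ℂ F V := hlim.differentiableOn (Eventually.of_forall hf) hV
  have hiso := ((hFd.analyticAt (hV.mem_nhds hb)).eventually_eq_zero_or_eventually_ne_zero
    ).resolve_left hF
  rw [eventually_nhdsWithin_iff] at hiso
  obtain ⟨R, hR, hRsub⟩ := Metric.eventually_nhds_iff_ball.mp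
    (hiso.and (hV.mem_nhds hb))
  set r := R / 2 with hr
  have hr0 : 0 < r := by positivity
  have hsub : closedBall b r ⊆ V := fun z hz =>
    (hRsub z (closedBall_subset_ball (by linarith) hz)).2
  have hsph : ∀ z ∈ sphere b r, F z ≠ 0 := fun z hz =>
    (hRsub z (closedBall_subset_ball (by linarith) (sphere_subset_closedBall hz))).1
      (ne_of_mem_sphere hz hr0.ne')
  obtain ⟨z₀, hz₀, hmin⟩ := (isCompact_sphere b r).exists_isMinOn
    (NormedSpace.sphere_nonempty.mpr hr0.le)
    ((hFd.continuousOn.mono (sphere_subset_closedBall.trans hsub)).norm)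
  set m := ‖F z₀‖ with hm
  have hm0 : 0 < m := norm_pos_iff.mpr (hsph z₀ hz₀)
  have hunif : TendstoUniformlyOn f F l (closedBall b r) :=
    (tendstoLocallyUniformlyOn_iff_forall_isCompact hV).mp hlim _ hsub (isCompact_closedBall b r)
  obtain ⟨n, hn⟩ := (Metric.tendstoUniformlyOn_iff.mp hunif (m / 3) (by positivity)).exists
  have hnb : ‖f n b‖ < m / 3 := by
    simpa [hFb, dist_eq_norm] using hn b (mem_closedBall_self hr0.le)
  have hbd : ∀ z ∈ frontier (ball b r), ‖(f n z)⁻¹‖ ≤ (2 * m / 3)⁻¹ := by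
    intro z hz
    rw [frontier_ball b hr0.ne'] at hz
    have h1 : m ≤ ‖F z‖ := hmin hz
    have h2 := hn z (sphere_subset_closedBall hz)
    rw [dist_eq_norm] at h2
    rw [norm_inv]
    apply inv_anti₀ (by positivity)
    linarith [norm_sub_norm_le (F z) (f n z)]
  have hinv : DiffContOnCl ℂ (fun z => (f n z)⁻¹) (ball b r) :=
    (((hf n).mono hsub).inv fun z hz => hne n z (hsub hz)).diffContOnCl_ball le_rfl
  have h3 := norm_le_of_forall_mem_frontier_norm_le isBounded_ball hinv hbd
    (subset_closure (mem_ball_self hr0))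
  rw [norm_inv] at h3
  have h4 := (inv_le_inv₀ (norm_pos_iff.mpr (hne n b hb)) (by positivity)).mp h3
  linarith

/-! ### The Riemann mapping theorem -/

/-- A conformal mapping of `U` into the unit disk. -/
structure IsConformalIntoDisk (f : ℂ → ℂ) (U : Set ℂ) : Prop where
  differentiableOn : DifferentiableOn ℂ f U
  mapsTo : MapsTo f U (ball 0 1)
  injOn : InjOn f U
  deriv_ne_zero : ∀ z ∈ U, deriv f z ≠ 0

lemma IsConformalIntoDisk.norm_lt_one {f : ℂ → ℂ} {U : Set ℂ} (hf : IsConformalIntoDisk f U)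
    {z : ℂ} (hz : z ∈ U) : ‖f z‖ < 1 := mem_ball_zero_iff.mp (hf.mapsTo hz)

lemma IsConformalIntoDisk.hasDerivAt {f : ℂ → ℂ} {U : Set ℂ} (hf : IsConformalIntoDisk f U)
    (hU : IsOpen U) {z : ℂ} (hz : z ∈ U) : HasDerivAt f (deriv f z) z :=
  (hf.differentiableOn.differentiableAt (hU.mem_nhds hz)).hasDerivAt

lemma IsConformalIntoDisk.diskAut_comp {f : ℂ → ℂ} {U : Set ℂ} (hU : IsOpen U)
    (hf : IsConformalIntoDisk f U) {a : ℂ} (ha : ‖a‖ < 1) :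
    IsConformalIntoDisk (fun z => diskAut a (f z)) U := by
  have hd : ∀ z ∈ U, HasDerivAt (fun z => diskAut a (f z)) _ z := fun z hz =>
    (hasDerivAt_diskAut ha (hf.norm_lt_one hz)).comp z (hf.hasDerivAt hU hz)
  refine ⟨fun z hz => (hd z hz).differentiableAt.differentiableWithinAt,
    fun z hz => mem_ball_zero_iff.mpr (norm_diskAut_lt_one ha (hf.norm_lt_one hz)),
    (diskAut_injOn ha).comp hf.injOn hf.mapsTo, fun z hz => ?_⟩
  rw [(hd z hz).deriv]
  exact mul_ne_zero (div_ne_zero (one_sub_conj_mul_ne_zero ha ha)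
    (pow_ne_zero 2 (one_sub_conj_mul_ne_zero ha (hf.norm_lt_one hz)))) (hf.deriv_ne_zero z hz)

/-- A holomorphic branch of the square root of a zero-free function. -/
lemma exists_sqrt {U : Set ℂ} (hU : IsOpen U) (hc : IsSimplyConnected U) {G : ℂ → ℂ}
    (hG : DifferentiableOn ℂ G U) (hG0 : ∀ z ∈ U, G z ≠ 0) :
    ∃ h : ℂ → ℂ, (∀ z, h z ^ 2 = G z) ∧ (∀ z ∈ U, h z ≠ 0) ∧
      ∀ z ∈ U, HasDerivAt h ((2 * h z)⁻¹ * deriv G z) z := by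
  obtain ⟨h, hcont, hsq⟩ := exists_continuousOn_pow_eq hc hU hG.continuousOn
    (by rintro ⟨z, hz, h⟩; exact hG0 z hz h) two_ne_zero
  have hh0 : ∀ z ∈ U, h z ≠ 0 := fun z hz hz0 => hG0 z hz (by rw [← hsq z, hz0]; simp)
  refine ⟨h, hsq, hh0, fun z hz => ?_⟩
  have h2 : 2 * h z ≠ 0 := mul_ne_zero two_ne_zero (hh0 z hz)
  have hps : HasStrictDerivAt (fun x : ℂ => x ^ 2) (2 * h z) (h z) := by
    simpa using hasStrictDerivAt_pow 2 (h z)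
  -- By continuity, `h` is the local inverse of squaring at `h z`, composed with `G`.
  have hinv := hps.to_localInverse h2
  rw [show h z ^ 2 = G z from hsq z] at hinv
  refine (hinv.hasDerivAt.comp z
    (hG.differentiableAt (hU.mem_nhds hz)).hasDerivAt).congr_of_eventuallyEq ?_
  filter_upwards [(hcont.continuousAt (hU.mem_nhds hz)).eventually
    (hps.eventually_left_inverse h2)] with x hx
  rw [hsq] at hx
  exact hx.symm

/-- If `a ∉ U`, a holomorphic square root `h` of `z - a` on `U` is injective, and `h '' U` is disjoint
from `-h '' U`. So `h` omits a disk, and an inversion in it maps `h '' U` into the unit disk. -/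
lemma exists_isConformalIntoDisk {U : Set ℂ} (hU : IsOpen U) (hc : IsSimplyConnected U)
    (hne : U ≠ univ) : ∃ f, IsConformalIntoDisk f U := by
  obtain ⟨a, ha⟩ := (ne_univ_iff_exists_notMem U).mp hne
  obtain ⟨h, hsq, hh0, hhd⟩ := exists_sqrt hU hc (G := fun z => z - a) (by fun_prop)
    fun z hz hza => ha (by rwa [← sub_eq_zero.mp hza])
  have hhd' : ∀ z ∈ U, HasDerivAt h (2 * h z)⁻¹ z := fun z hz => by
    simpa using hhd z hz
  have hdiff : DifferentiableOn ℂ h U := fun z hz =>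
    (hhd' z hz).differentiableAt.differentiableWithinAt
  have hder : ∀ z ∈ U, deriv h z ≠ 0 := fun z hz => by
    rw [(hhd' z hz).deriv]
    exact inv_ne_zero (mul_ne_zero two_ne_zero (hh0 z hz))
  have hinj : ∀ z w, h z ^ 2 = h w ^ 2 → z = w := fun z w hzw => by
    rw [hsq, hsq] at hzw
    exact sub_left_injective hzw
  obtain ⟨z₀, hz₀⟩ := hc.nonempty
  have himg : h '' U ∈ 𝓝 (h z₀) := by
    rw [← (hasStrictDerivAt_of_differentiableOn hU hdiff hz₀).map_nhds_eq (hder z₀ hz₀)]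
    exact image_mem_map (hU.mem_nhds hz₀)
  obtain ⟨ε, hε, hball⟩ := Metric.mem_nhds_iff.mp himg
  have hfar : ∀ z ∈ U, ε ≤ ‖h z + h z₀‖ := by
    intro z hz
    by_contra hcon
    obtain ⟨w, hw, hwz⟩ := hball (show -h z ∈ ball (h z₀) ε by
      rw [mem_ball, dist_eq_norm, ← norm_neg]
      simpa [add_comm] using hcon)
    have hzw : w = z := hinj w z (by rw [hwz, neg_sq])
    rw [hzw] at hwz
    exact hh0 z hz (by linear_combination hwz / 2)
  have hsum : ∀ z ∈ U, h z + h z₀ ≠ 0 := fun z hz =>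
    norm_pos_iff.mp (hε.trans_le (hfar z hz))
  have hε2 : ((ε / 2 : ℝ) : ℂ) ≠ 0 := ofReal_ne_zero.mpr (by positivity)
  have hd : ∀ z ∈ U, HasDerivAt (fun z => ((ε / 2 : ℝ) : ℂ) * (h z + h z₀)⁻¹)
      (((ε / 2 : ℝ) : ℂ) * (-(2 * h z)⁻¹ / (h z + h z₀) ^ 2)) z := fun z hz =>
    (((hhd' z hz).add_const (h z₀)).fun_inv (hsum z hz)).const_mul _
  refine ⟨fun z => ((ε / 2 : ℝ) : ℂ) * (h z + h z₀)⁻¹,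
    fun z hz => (hd z hz).differentiableAt.differentiableWithinAt, fun z hz => ?_,
    fun z _ w _ hzw => ?_, fun z hz => ?_⟩
  · rw [mem_ball_zero_iff, norm_mul, norm_inv, norm_real, Real.norm_of_nonneg (by positivity),
      ← div_eq_mul_inv, div_lt_one (hε.trans_le (hfar z hz))]
    linarith [hfar z hz]
  · have := add_right_cancel (inv_injective (mul_left_cancel₀ hε2 hzw))
    exact hinj z w (by rw [this])
  · rw [(hd z hz).deriv]
    exact mul_ne_zero hε2 (div_ne_zero (neg_ne_zero.mpr (inv_ne_zero
      (mul_ne_zero two_ne_zero (hh0 z hz)))) (pow_ne_zero 2 (hsum z hz)))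

/-- Among the conformal mappings of `U` into the unit disk there is one with the largest derivative
at a given point. -/
lemma exists_maximal_isConformalIntoDisk {U : Set ℂ} (hU : IsOpen U) (hc : IsPreconnected U)
    (hne : ∃ f, IsConformalIntoDisk f U) {z₀ : ℂ} (hz₀ : z₀ ∈ U) :
    ∃ F, IsConformalIntoDisk F U ∧
      ∀ f, IsConformalIntoDisk f U → ‖deriv f z₀‖ ≤ ‖deriv F z₀‖ := by
  set S : Set ℝ := {x | ∃ f, IsConformalIntoDisk f U ∧ ‖deriv f z₀‖ = x} with hS
  obtain ⟨f₀, hf₀⟩ := hne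
  have hSne : S.Nonempty := ⟨_, f₀, hf₀, rfl⟩
  obtain ⟨r, hr, hrU⟩ := Metric.isOpen_iff.mp hU z₀ hz₀
  have hSbdd : BddAbove S := by
    refine ⟨1 / r, ?_⟩
    rintro _ ⟨f, hf, rfl⟩
    rw [le_div_iff₀ hr, mul_comm]
    have := norm_deriv_center_le hr (hf.differentiableOn.mono hrU) (hf.mapsTo.mono_left hrU)
    nlinarith [norm_nonneg (f z₀)]
  obtain ⟨u, -, hu, huS⟩ := exists_seq_tendsto_sSup hSne hSbdd
  choose f hf hfu using huS
  obtain ⟨F, hF⟩ := exists_tendstoLocallyUniformlyOn (hyperfilter ℕ) hU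
    (fun n => (hf n).differentiableOn) (fun n => (hf n).mapsTo)
  have hl : (hyperfilter ℕ : Filter ℕ) ≤ atTop := by
    rw [← Nat.cofinite_eq_atTop]; exact hyperfilter_le_cofinite
  have hFd : DifferentiableOn ℂ F U :=
    hF.differentiableOn (Eventually.of_forall fun n => (hf n).differentiableOn) hU
  have hF' := hF.deriv (Eventually.of_forall fun n => (hf n).differentiableOn) hU
  have hval : ‖deriv F z₀‖ = sSup S := by
    refine tendsto_nhds_unique (hF'.tendsto_at hz₀).norm ?_
    simpa only [Function.comp_apply, hfu] using hu.mono_left hl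
  have hmax : ∀ g, IsConformalIntoDisk g U → ‖deriv g z₀‖ ≤ ‖deriv F z₀‖ := fun g hg => by
    rw [hval]; exact le_csSup hSbdd ⟨g, hg, rfl⟩
  have hpos : deriv F z₀ ≠ 0 := norm_pos_iff.mp
    ((norm_pos_iff.mpr (hf₀.deriv_ne_zero z₀ hz₀)).trans_le (hmax f₀ hf₀))
  have hFan : AnalyticOnNhd ℂ F U := hFd.analyticOnNhd hU
  -- By the identity theorem, `F` is not locally constant anywhere.
  have hnc : ∀ b ∈ U, ∀ y : ℂ, ¬ ∀ᶠ z in 𝓝 b, F z - y = 0 := by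
    intro b hb y h
    have h1 : EqOn F (fun _ => y) U :=
      hFan.eqOn_of_preconnected_of_eventuallyEq analyticOnNhd_const hc hb
        (h.mono fun z hz => sub_eq_zero.mp hz)
    exact hpos ((h1.eventuallyEq_of_mem (hU.mem_nhds hz₀)).deriv_eq.trans (deriv_const _ _))
  have hderiv : ∀ z ∈ U, deriv F z ≠ 0 := by
    intro b hb
    refine ne_zero_of_tendstoLocallyUniformlyOn hU (fun n => (hf n).differentiableOn.deriv hU) hF'
      (fun n => (hf n).deriv_ne_zero) hb fun h => ?_
    exact hpos (hFan.deriv.eqOn_zero_of_preconnected_of_eventuallyEq_zero hc hb h hz₀)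
  have hinj : InjOn F U := by
    intro a ha b hb hab
    by_contra hne
    have hV : IsOpen (U ∩ {a}ᶜ) := hU.inter isOpen_compl_singleton
    have hlimV : TendstoLocallyUniformlyOn (fun n z => f n z - f n a) (fun z => F z - F a)
        (hyperfilter ℕ) (U ∩ {a}ᶜ) := by
      have hconst : TendstoLocallyUniformlyOn (fun n (_ : ℂ) => f n a) (fun _ => F a)
          (hyperfilter ℕ) (U ∩ {a}ᶜ) := by
        rw [Metric.tendstoLocallyUniformlyOn_iff]
        intro ε hε x _
        refine ⟨univ, univ_mem, ?_⟩
        filter_upwards [Metric.tendsto_nhds.mp (hF.tendsto_at ha) ε hε] with n hn y _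
        rwa [dist_comm]
      exact (hF.mono inter_subset_left).sub hconst
    refine ne_zero_of_tendstoLocallyUniformlyOn hV
      (fun n => ((hf n).differentiableOn.mono inter_subset_left).sub_const _) hlimV
      (fun n z hz h => hz.2 ((hf n).injOn hz.1 ha (sub_eq_zero.mp h)))
      (⟨hb, fun h => hne h.symm⟩ : b ∈ U ∩ {a}ᶜ) (hnc b hb (F a)) (by rw [hab, sub_self])
  refine ⟨F, ⟨hFd, fun z hz => ?_, hinj, hderiv⟩, hmax⟩
  -- `F` maps into the closed disk; being open, it maps into the interior.
  have hcl : MapsTo F U (closedBall 0 1) := fun z hz => isClosed_closedBall.mem_of_tendsto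
    (hF.tendsto_at hz) (Eventually.of_forall fun n => ball_subset_closedBall ((hf n).mapsTo hz))
  rw [← interior_closedBall (0 : ℂ) one_ne_zero, mem_interior_iff_mem_nhds,
    ← (hasStrictDerivAt_of_differentiableOn hU hFd hz).map_nhds_eq (hderiv z hz)]
  exact mem_map.mpr (mem_of_superset (hU.mem_nhds hz) hcl)

/-- If a conformal mapping into the disk, normalized at `z₀`, omits a value, then **Koebe's
square-root transform** gives one with a larger derivative at `z₀`. -/
lemma exists_norm_deriv_lt_of_notMem_image {U : Set ℂ} (hU : IsOpen U) (hc : IsSimplyConnected U)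
    {F : ℂ → ℂ} (hF : IsConformalIntoDisk F U) {z₀ : ℂ} (hz₀ : z₀ ∈ U) (h0 : F z₀ = 0) {w : ℂ}
    (hw : ‖w‖ < 1) (hwF : w ∉ F '' U) :
    ∃ k, IsConformalIntoDisk k U ∧ ‖deriv F z₀‖ < ‖deriv k z₀‖ := by
  have hG := hF.diskAut_comp hU hw
  set G : ℂ → ℂ := fun z => diskAut w (F z) with hGdef
  have hG0 : ∀ z ∈ U, G z ≠ 0 := by
    intro z hz h
    refine hwF ⟨z, hz, diskAut_injOn hw (hF.mapsTo hz) (mem_ball_zero_iff.mpr hw) ?_⟩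
    rw [diskAut_self]; exact h
  obtain ⟨h, hsq, hh0, hhd⟩ := exists_sqrt hU hc hG.differentiableOn hG0
  have hH : IsConformalIntoDisk h U := by
    refine ⟨fun z hz => (hhd z hz).differentiableAt.differentiableWithinAt, fun z hz => ?_,
      fun z hz x hx hzx => hG.injOn hz hx (by rw [← hsq z, ← hsq x, hzx]), fun z hz => ?_⟩
    · rw [mem_ball_zero_iff, ← pow_lt_one_iff_of_nonneg (norm_nonneg _) two_ne_zero, ← norm_pow,
        hsq]
      exact hG.norm_lt_one hz
    · rw [(hhd z hz).deriv]
      exact mul_ne_zero (inv_ne_zero (mul_ne_zero two_ne_zero (hh0 z hz))) (hG.deriv_ne_zero z hz)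
  refine ⟨fun z => diskAut (h z₀) (h z), hH.diskAut_comp hU (hH.norm_lt_one hz₀), ?_⟩
  rw [norm_deriv_diskAut_comp_self (hhd z₀ hz₀).differentiableAt (hH.norm_lt_one hz₀),
    (hhd z₀ hz₀).deriv]
  have hF0 : HasDerivAt (diskAut w) ((1 - conj w * w) / (1 - conj w * 0) ^ 2) (F z₀) := by
    rw [h0]; exact hasDerivAt_diskAut hw (by simp)
  have hGd : ‖deriv G z₀‖ = (1 - ‖w‖ ^ 2) * ‖deriv F z₀‖ := by
    have := (hF0.comp z₀ (hF.hasDerivAt hU hz₀)).deriv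
    rw [show G = diskAut w ∘ F from rfl, this, norm_mul, norm_div,
      norm_one_sub_conj_mul_self hw]
    simp
  have hs : ‖h z₀‖ ^ 2 = ‖w‖ := by
    rw [← norm_pow, hsq, hGdef]
    simp [h0, diskAut_zero]
  have hs0 : 0 < ‖h z₀‖ := norm_pos_iff.mpr (hh0 z₀ hz₀)
  have hs1 := hH.norm_lt_one hz₀
  have hd0 : 0 < ‖deriv F z₀‖ := norm_pos_iff.mpr (hF.deriv_ne_zero z₀ hz₀)
  rw [norm_mul, norm_inv, norm_mul, hGd, ← hs]
  set s := ‖h z₀‖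
  set d := ‖deriv F z₀‖
  have h1 : 0 < 1 - s ^ 2 := by nlinarith
  have hfac : (‖(2 : ℂ)‖ * s)⁻¹ * ((1 - (s ^ 2) ^ 2) * d) / (1 - s ^ 2)
      = d * ((1 + s ^ 2) / (2 * s)) := by
    rw [show ‖(2 : ℂ)‖ = 2 by simp]
    field_simp
    ring
  rw [hfac]
  have : 1 < (1 + s ^ 2) / (2 * s) := by
    rw [one_lt_div (by positivity)]
    nlinarith [mul_pos (sub_pos.mpr hs1) (sub_pos.mpr hs1)]
  nlinarith

/-- The **Riemann mapping theorem**. -/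
theorem exists_isConformalDiskMap {U : Set ℂ} (hU : IsOpen U) (hc : IsSimplyConnected U)
    (hne : U ≠ univ) : ∃ φ, IsConformalDiskMap φ U := by
  obtain ⟨z₀, hz₀⟩ := hc.nonempty
  obtain ⟨F, hF, hmax⟩ := exists_maximal_isConformalIntoDisk hU
    hc.isPathConnected.isConnected.isPreconnected
    (exists_isConformalIntoDisk hU hc hne) hz₀
  have hd0 : 0 < ‖deriv F z₀‖ := norm_pos_iff.mpr (hF.deriv_ne_zero z₀ hz₀)
  have h0 : F z₀ = 0 := by
    have h := hmax _ (hF.diskAut_comp hU (hF.norm_lt_one hz₀))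
    have hlt := hF.norm_lt_one hz₀
    have hp : 0 < 1 - ‖F z₀‖ ^ 2 := by nlinarith [norm_nonneg (F z₀)]
    rw [norm_deriv_diskAut_comp_self (hF.hasDerivAt hU hz₀).differentiableAt hlt,
      div_le_iff₀ hp] at h
    have : ‖F z₀‖ ^ 2 ≤ 0 := by
      by_contra hcon
      nlinarith [mul_pos hd0 (not_le.mp hcon)]
    exact norm_eq_zero.mp (pow_eq_zero_iff two_ne_zero |>.mp (le_antisymm this (sq_nonneg _)))
  have hsurj : SurjOn F U (ball 0 1) := by
    intro w hw
    by_contra hwF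
    obtain ⟨k, hk, hlt⟩ := exists_norm_deriv_lt_of_notMem_image hU hc hF hz₀ h0
      (mem_ball_zero_iff.mp hw) hwF
    exact absurd (hmax k hk) (not_le.mpr hlt)
  have hbij : BijOn F U (ball 0 1) := ⟨hF.mapsTo, hF.injOn, hsurj⟩
  have hinv := hbij.invOn_invFunOn
  have hd : ∀ w ∈ ball (0 : ℂ) 1, ∃ d ≠ 0, HasDerivAt (Function.invFunOn F U) d w := by
    intro w hw
    obtain ⟨z, hz, rfl⟩ := hsurj hw
    exact ⟨_, inv_ne_zero (hF.deriv_ne_zero z hz), (hasStrictDerivAt_leftInverse hU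
      hF.differentiableOn hinv.1 hz (hF.deriv_ne_zero z hz)).hasDerivAt⟩
  refine ⟨Function.invFunOn F U, fun w hw => ?_, fun w hw => ?_,
    hbij.symm hinv.symm⟩
  · obtain ⟨d, -, hd⟩ := hd w hw
    exact hd.differentiableAt.differentiableWithinAt
  · obtain ⟨d, hd0, hd⟩ := hd w hw
    rwa [hd.deriv]

/-! ### The hyperbolic density -/

lemma isInducedDensity_hyperbolicDensity {D : Set ℂ} {z : ℂ} (hz : z ∈ D)
    (hD : ∃ φ, IsConformalDiskMap φ D) : IsInducedDensity D z (hyperbolicDensity D z) := by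
  have h : ∃ ρ : ℝ, IsInducedDensity D z ρ := by
    obtain ⟨φ, hφ⟩ := hD
    obtain ⟨w, hw, hwz⟩ := hφ.bijOn.surjOn hz
    exact ⟨1 / (1 - ‖w‖ ^ 2) / ‖deriv φ w‖, φ, hφ, w, hw, hwz,
      div_mul_cancel₀ _ (norm_ne_zero_iff.mpr (hφ.deriv_ne_zero w hw))⟩
  rw [hyperbolicDensity, dif_pos h]
  exact h.choose_spec

/-- The density of the hyperbolic metric is the pull-back of that of the unit disk under some
conformal mapping `ψ` of `D` into the unit disk. -/
lemma exists_norm_deriv_eq {D : Set ℂ} {z : ℂ} (hz : z ∈ D) (hD : ∃ φ, IsConformalDiskMap φ D) :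
    ∃ ψ, IsConformalIntoDisk ψ D ∧ ‖deriv ψ z‖ = hyperbolicDensity D z * (1 - ‖ψ z‖ ^ 2) := by
  obtain ⟨φ, hφ, w, hw, hwz, hρ⟩ := isInducedDensity_hyperbolicDensity hz hD
  have hinv := hφ.bijOn.invOn_invFunOn
  have hbij := BijOn.symm hinv.symm hφ.bijOn
  have hd : ∀ x ∈ ball (0 : ℂ) 1,
      HasDerivAt (Function.invFunOn φ (ball 0 1)) (deriv φ x)⁻¹ (φ x) := fun x hx =>
    (hasStrictDerivAt_leftInverse isOpen_ball hφ.differentiableOn hinv.1 hx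
      (hφ.deriv_ne_zero x hx)).hasDerivAt
  refine ⟨Function.invFunOn φ (ball 0 1), ⟨fun y hy => ?_, hbij.mapsTo, hbij.injOn,
    fun y hy => ?_⟩, ?_⟩
  · obtain ⟨x, hx, rfl⟩ := hφ.bijOn.surjOn hy
    exact (hd x hx).differentiableAt.differentiableWithinAt
  · obtain ⟨x, hx, rfl⟩ := hφ.bijOn.surjOn hy
    rw [(hd x hx).deriv]
    exact inv_ne_zero (hφ.deriv_ne_zero x hx)
  · have hn : ‖deriv φ w‖ ≠ 0 := norm_ne_zero_iff.mpr (hφ.deriv_ne_zero w hw)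
    have hw1 : 1 - ‖w‖ ^ 2 ≠ 0 := by
      have := mem_ball_zero_iff.mp hw
      nlinarith [norm_nonneg w]
    rw [← hwz, (hd w hw).deriv, hinv.1 hw, hwz, norm_inv]
    field_simp at hρ ⊢
    linarith

/-- The **Schwarz–Pick inequality** for holomorphic maps from a hyperbolic domain to the disk. -/
lemma norm_deriv_le_hyperbolicDensity_mul {D : Set ℂ} (hDo : IsOpen D) {z : ℂ} (hz : z ∈ D)
    (hD : ∃ φ, IsConformalDiskMap φ D) {ω : ℂ → ℂ} (hω : DifferentiableOn ℂ ω D)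
    (hmaps : MapsTo ω D (ball 0 1)) :
    ‖deriv ω z‖ ≤ hyperbolicDensity D z * (1 - ‖ω z‖ ^ 2) := by
  obtain ⟨φ, hφ, w, hw, hwz, hρ⟩ := isInducedDensity_hyperbolicDensity hz hD
  have h := norm_deriv_le_of_mapsTo_unitBall (hω.comp hφ.differentiableOn hφ.bijOn.mapsTo)
    (hmaps.comp hφ.bijOn.mapsTo) (mem_ball_zero_iff.mp hw)
  have hωd : HasDerivAt ω (deriv ω z) (φ w) := by
    rw [hwz]
    exact (hω.differentiableAt (hDo.mem_nhds hz)).hasDerivAt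
  rw [(hωd.comp w (hφ.differentiableOn.differentiableAt (isOpen_ball.mem_nhds hw)).hasDerivAt
    ).deriv, Function.comp_apply, hwz, norm_mul] at h
  have hn : 0 < ‖deriv φ w‖ := norm_pos_iff.mpr (hφ.deriv_ne_zero w hw)
  have hw1 : 0 < 1 - ‖w‖ ^ 2 := by
    have := mem_ball_zero_iff.mp hw
    nlinarith [norm_nonneg w]
  have hρ' : hyperbolicDensity D z = ((1 - ‖w‖ ^ 2) * ‖deriv φ w‖)⁻¹ := by
    field_simp at hρ ⊢
    linarith
  rw [hρ', inv_mul_eq_div, le_div_iff₀ (by positivity)]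
  linarith

lemma hyperbolicDensity_pos {D : Set ℂ} {z : ℂ} (hz : z ∈ D) (hD : ∃ φ, IsConformalDiskMap φ D) :
    0 < hyperbolicDensity D z := by
  obtain ⟨ψ, hψ, h⟩ := exists_norm_deriv_eq hz hD
  have h1 : 0 < 1 - ‖ψ z‖ ^ 2 := by nlinarith [norm_nonneg (ψ z), hψ.norm_lt_one hz]
  have h2 : 0 < ‖deriv ψ z‖ := norm_pos_iff.mpr (hψ.deriv_ne_zero z hz)
  rw [h] at h2
  exact pos_of_mul_pos_left h2 h1.le

lemma hyperbolicDensity_ball_center_le {c : ℂ} {r : ℝ} (hr : 0 < r)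
    (hD : ∃ φ, IsConformalDiskMap φ (ball c r)) : hyperbolicDensity (ball c r) c ≤ r⁻¹ := by
  obtain ⟨ψ, hψ, h⟩ := exists_norm_deriv_eq (mem_ball_self hr) hD
  have h1 : 0 < 1 - ‖ψ c‖ ^ 2 := by
    nlinarith [norm_nonneg (ψ c), hψ.norm_lt_one (mem_ball_self hr)]
  have h2 := norm_deriv_center_le hr hψ.differentiableOn hψ.mapsTo
  rw [h, ← mul_assoc] at h2
  have h3 : r * hyperbolicDensity (ball c r) c ≤ 1 := by
    by_contra hcon
    nlinarith
  rw [← one_div, le_div_iff₀ hr]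
  linarith

/-! ### The Jacobian and the pre-Schwarzian of a harmonic mapping -/

lemma det_eq_normSq_sub_normSq (L : ℂ →L[ℝ] ℂ) (a b : ℂ)
    (hL : ∀ v, L v = a * v + conj (b * v)) : L.det = ‖a‖ ^ 2 - ‖b‖ ^ 2 := by
  rw [ContinuousLinearMap.det, ← LinearMap.det_toMatrix basisOneI, Matrix.det_fin_two]
  simp only [LinearMap.toMatrix_apply, coe_basisOneI, coe_basisOneI_repr,
    ContinuousLinearMap.coe_coe, hL]
  simp [← normSq_eq_norm_sq, normSq_apply]
  ring

section

variable {D : Set ℂ} {f h g : ℂ → ℂ} {z : ℂ}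

lemma jacobian_eq (hD : IsOpen D) (hf : IsAnalyticDecomposition f h g D) (hz : z ∈ D) :
    jacobian f z = ‖deriv h z‖ ^ 2 - ‖deriv g z‖ ^ 2 := by
  have hh := (hf.left.differentiableAt (hD.mem_nhds hz)).hasDerivAt
  have hg := (hf.right.differentiableAt (hD.mem_nhds hz)).hasDerivAt
  have h1 : HasFDerivAt (fun z => h z + conj (g z)) _ z :=
    (hh.hasFDerivAt.restrictScalars ℝ).add
      (conjCLE.toContinuousLinearMap.hasFDerivAt.comp z (hg.hasFDerivAt.restrictScalars ℝ))
  have h2 := h1.congr_of_eventuallyEq (hf.eqOn.eventuallyEq_of_mem (hD.mem_nhds hz))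
  rw [jacobian, h2.fderiv]
  apply det_eq_normSq_sub_normSq
  intro v
  simp [mul_comm]

lemma hasFDerivAt_norm_sq {F : ℂ → ℂ} {F' : ℂ} (hF : HasDerivAt F F' z) :
    ∃ L : ℂ →L[ℝ] ℝ, HasFDerivAt (fun x => ‖F x‖ ^ 2) L z ∧
      ∀ v, L v = 2 * (conj (F z) * F' * v).re := by
  have h := (hF.hasFDerivAt.restrictScalars ℝ).norm_sq
  refine ⟨_, h, fun v => ?_⟩
  simp [Complex.inner]
  ring

/-- `P_f = (h'' * conj h' - g'' * conj g') / J_f`. -/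
lemma harmonicPreSchwarzian_eq (hD : IsOpen D) (hf : IsAnalyticDecomposition f h g D)
    (hz : z ∈ D) (hJ : 0 < jacobian f z) :
    harmonicPreSchwarzian f z =
      (conj (deriv h z) * deriv (deriv h) z - conj (deriv g z) * deriv (deriv g) z) /
        ((‖deriv h z‖ ^ 2 - ‖deriv g z‖ ^ 2 : ℝ) : ℂ) := by
  rw [jacobian_eq hD hf hz] at hJ
  obtain ⟨L₁, h₁, hL₁⟩ := hasFDerivAt_norm_sq
    ((hf.left.deriv hD).differentiableAt (hD.mem_nhds hz)).hasDerivAt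
  obtain ⟨L₂, h₂, hL₂⟩ := hasFDerivAt_norm_sq
    ((hf.right.deriv hD).differentiableAt (hD.mem_nhds hz)).hasDerivAt
  have hlog := ofRealCLM.hasFDerivAt.comp z ((h₁.fun_sub h₂).log hJ.ne')
  have hev : (fun w => (Real.log (jacobian f w) : ℂ)) =ᶠ[𝓝 z]
      ofRealCLM ∘ fun w => Real.log (‖deriv h w‖ ^ 2 - ‖deriv g w‖ ^ 2) := by
    filter_upwards [hD.mem_nhds hz] with w hw
    simp [jacobian_eq hD hf hw]
  rw [harmonicPreSchwarzian, wirtingerDeriv, (hlog.congr_of_eventuallyEq hev).fderiv]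
  set J := ‖deriv h z‖ ^ 2 - ‖deriv g z‖ ^ 2
  set A := conj (deriv h z) * deriv (deriv h) z
  set B := conj (deriv g z) * deriv (deriv g) z
  have hJ' : (J : ℂ) ≠ 0 := ofReal_ne_zero.mpr hJ.ne'
  simp only [ContinuousLinearMap.comp_apply, _root_.smul_apply,
    _root_.sub_apply, hL₁, hL₂, ofRealCLM_apply, smul_eq_mul]
  rw [eq_div_iff hJ']
  push_cast
  have hA : ∀ w : ℂ, 2 * ((w * 1).re : ℂ) - I * (2 * ((w * I).re : ℂ)) = 2 * w := by
    intro w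
    apply Complex.ext <;> simp
  have e : ((J : ℂ)⁻¹ * (2 * ((A * 1).re : ℂ) - 2 * ((B * 1).re : ℂ)) -
      I * ((J : ℂ)⁻¹ * (2 * ((A * I).re : ℂ) - 2 * ((B * I).re : ℂ)))) / 2 * J
      = (J : ℂ)⁻¹ * J * ((2 * ((A * 1).re : ℂ) - I * (2 * ((A * I).re : ℂ))) -
        (2 * ((B * 1).re : ℂ) - I * (2 * ((B * I).re : ℂ)))) / 2 := by ring
  rw [e, hA, hA, inv_mul_cancel₀ hJ']
  ring

lemma norm_deriv_lt_of_jacobian_pos (hD : IsOpen D) (hf : IsAnalyticDecomposition f h g D)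
    (hz : z ∈ D) (hJ : 0 < jacobian f z) : ‖deriv g z‖ < ‖deriv h z‖ := by
  rw [jacobian_eq hD hf hz] at hJ
  exact lt_of_pow_lt_pow_left₀ 2 (norm_nonneg _) (by linarith)

/-- `h + conj g` is a sense-preserving harmonic mapping if `|g'| < |h'|`. -/
lemma isSensePreservingHarmonic_of_norm_deriv_lt (hD : IsOpen D) (hh : DifferentiableOn ℂ h D)
    (hg : DifferentiableOn ℂ g D) (hlt : ∀ z ∈ D, ‖deriv g z‖ < ‖deriv h z‖) :
    IsSensePreservingHarmonic (fun z => h z + conj (g z)) D ∧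
      IsAnalyticDecomposition (fun z => h z + conj (g z)) h g D := by
  have hdec : IsAnalyticDecomposition (fun z => h z + conj (g z)) h g D :=
    ⟨hh, hg, fun _ _ => rfl⟩
  refine ⟨⟨fun z hz => ?_, fun z hz => ?_⟩, hdec⟩
  · exact (hh.analyticAt (hD.mem_nhds hz)).harmonicAt.add
      ((hg.analyticAt (hD.mem_nhds hz)).harmonicAt.comp_CLM conjCLE.toContinuousLinearMap)
  · rw [jacobian_eq hD hdec hz, sub_pos]
    exact pow_lt_pow_left₀ (hlt z hz) (norm_nonneg _) two_ne_zero

lemma hasDerivAt_shear (hD : IsOpen D) (hh : DifferentiableOn ℂ h D)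
    (hg : DifferentiableOn ℂ g D) (ε : ℂ) (hz : z ∈ D) :
    HasDerivAt (shear h g ε) (deriv h z + ε * deriv g z) z :=
  (hh.differentiableAt (hD.mem_nhds hz)).hasDerivAt.add
    ((hg.differentiableAt (hD.mem_nhds hz)).hasDerivAt.const_mul ε)

lemma preSchwarzian_shear (hD : IsOpen D) (hh : DifferentiableOn ℂ h D)
    (hg : DifferentiableOn ℂ g D) (ε : ℂ) (hz : z ∈ D) :
    preSchwarzian (shear h g ε) z =
      (deriv (deriv h) z + ε * deriv (deriv g) z) / (deriv h z + ε * deriv g z) := by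
  have hev : deriv (shear h g ε) =ᶠ[𝓝 z] shear (deriv h) (deriv g) ε := by
    filter_upwards [hD.mem_nhds hz] with w hw using (hasDerivAt_shear hD hh hg ε hw).deriv
  rw [preSchwarzian, hev.deriv_eq, (hasDerivAt_shear hD hh hg ε hz).deriv,
    (hasDerivAt_shear hD (hh.deriv hD) (hg.deriv hD) ε hz).deriv]

lemma add_mul_ne_zero_of_norm_lt {a b ε : ℂ} (hlt : ‖b‖ < ‖a‖) (hε : ‖ε‖ ≤ 1) :
    a + ε * b ≠ 0 := by
  intro h0
  have h1 : ‖a‖ = ‖ε * b‖ := by rw [eq_neg_of_add_eq_zero_left h0, norm_neg]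
  rw [norm_mul] at h1
  nlinarith [norm_nonneg b]

lemma norm_sq_add_mul_sub (a b ε : ℂ) :
    ‖a + ε * b‖ ^ 2 - ‖ε * conj a + conj b‖ ^ 2 = (1 - ‖ε‖ ^ 2) * (‖a‖ ^ 2 - ‖b‖ ^ 2) := by
  simp only [← normSq_eq_norm_sq, normSq_apply, add_re, add_im, mul_re, mul_im, conj_re, conj_im]
  ring

/-- With the dilatation `ω = g' / h'`, the difference of the two pre-Schwarzians is
`ω' * (ε + conj ω) / ((1 + ε * ω) * (1 - |ω| ^ 2))`. -/
lemma norm_preSchwarzian_sub_eq (hD : IsOpen D) (hf : IsAnalyticDecomposition f h g D)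
    (hz : z ∈ D) (hJ : 0 < jacobian f z) {ε : ℂ} (hε : ‖ε‖ ≤ 1) :
    ‖preSchwarzian (shear h g ε) z - harmonicPreSchwarzian f z‖ =
      ‖deriv (fun w => deriv g w / deriv h w) z‖ / (1 - ‖deriv g z / deriv h z‖ ^ 2) *
        (‖ε * conj (deriv h z) + conj (deriv g z)‖ / ‖deriv h z + ε * deriv g z‖) := by
  have hlt := norm_deriv_lt_of_jacobian_pos hD hf hz hJ
  have ha : 0 < ‖deriv h z‖ := (norm_nonneg _).trans_lt hlt
  have ha0 : deriv h z ≠ 0 := norm_pos_iff.mp ha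
  have hs := add_mul_ne_zero_of_norm_lt hlt hε
  have hω := (((hf.right.deriv hD).differentiableAt (hD.mem_nhds hz)).hasDerivAt.fun_div
    ((hf.left.deriv hD).differentiableAt (hD.mem_nhds hz)).hasDerivAt ha0).deriv
  rw [harmonicPreSchwarzian_eq hD hf hz hJ, preSchwarzian_shear hD hf.left hf.right ε hz, hω]
  rw [jacobian_eq hD hf hz] at hJ
  have hJ' : ((‖deriv h z‖ ^ 2 - ‖deriv g z‖ ^ 2 : ℝ) : ℂ) ≠ 0 := ofReal_ne_zero.mpr hJ.ne'
  have hJc : ((‖deriv h z‖ ^ 2 - ‖deriv g z‖ ^ 2 : ℝ) : ℂ) =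
      conj (deriv h z) * deriv h z - conj (deriv g z) * deriv g z := by
    rw [conj_mul', conj_mul']; push_cast; rfl
  have key : (deriv (deriv h) z + ε * deriv (deriv g) z) / (deriv h z + ε * deriv g z) -
      (conj (deriv h z) * deriv (deriv h) z - conj (deriv g z) * deriv (deriv g) z) /
        ((‖deriv h z‖ ^ 2 - ‖deriv g z‖ ^ 2 : ℝ) : ℂ) =
      (deriv (deriv g) z * deriv h z - deriv g z * deriv (deriv h) z) *
        (ε * conj (deriv h z) + conj (deriv g z)) /
        ((deriv h z + ε * deriv g z) * ((‖deriv h z‖ ^ 2 - ‖deriv g z‖ ^ 2 : ℝ) : ℂ)) := by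
    rw [div_sub_div _ _ hs hJ', hJc]
    congr 1
    ring
  rw [key]
  simp only [norm_div, norm_mul, norm_pow, norm_real, Real.norm_of_nonneg hJ.le]
  have hs' : ‖deriv h z + ε * deriv g z‖ ≠ 0 := norm_ne_zero_iff.mpr hs
  have h1 : 1 - (‖deriv g z‖ / ‖deriv h z‖) ^ 2
      = (‖deriv h z‖ ^ 2 - ‖deriv g z‖ ^ 2) / ‖deriv h z‖ ^ 2 := by
    field_simp
  rw [h1]
  field_simp

lemma norm_preSchwarzian_sub_le (hD : IsOpen D) (hD' : ∃ φ, IsConformalDiskMap φ D)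
    (hfs : IsSensePreservingHarmonic f D) (hf : IsAnalyticDecomposition f h g D)
    (hz : z ∈ D) {ε : ℂ} (hε : ‖ε‖ ≤ 1) :
    (hyperbolicDensity D z)⁻¹ *
      ‖preSchwarzian (shear h g ε) z - harmonicPreSchwarzian f z‖ ≤ 1 := by
  have hlt : ∀ w ∈ D, ‖deriv g w‖ < ‖deriv h w‖ := fun w hw =>
    norm_deriv_lt_of_jacobian_pos hD hf hw (hfs.2 w hw)
  have hh0 : ∀ w ∈ D, deriv h w ≠ 0 := fun w hw =>
    norm_pos_iff.mp ((norm_nonneg _).trans_lt (hlt w hw))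
  have hω : MapsTo (fun w => deriv g w / deriv h w) D (ball 0 1) := fun w hw => by
    rw [mem_ball_zero_iff, norm_div, div_lt_one (norm_pos_iff.mpr (hh0 w hw))]
    exact hlt w hw
  have hSP := norm_deriv_le_hyperbolicDensity_mul hD hz hD'
    ((hf.right.deriv hD).fun_div (hf.left.deriv hD) hh0) hω
  have hω1 := mem_ball_zero_iff.mp (hω hz)
  have hpos : 0 < 1 - ‖deriv g z / deriv h z‖ ^ 2 := by
    nlinarith [norm_nonneg (deriv g z / deriv h z)]
  have hs : 0 < ‖deriv h z + ε * deriv g z‖ :=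
    norm_pos_iff.mpr (add_mul_ne_zero_of_norm_lt (hlt z hz) hε)
  have hquot : ‖ε * conj (deriv h z) + conj (deriv g z)‖ / ‖deriv h z + ε * deriv g z‖ ≤ 1 := by
    rw [div_le_one hs]
    refine le_of_sq_le_sq ?_ hs.le
    have := norm_sq_add_mul_sub (deriv h z) (deriv g z) ε
    have h1 : 0 ≤ (1 - ‖ε‖ ^ 2) * (‖deriv h z‖ ^ 2 - ‖deriv g z‖ ^ 2) := by
      have := hlt z hz
      apply mul_nonneg <;> nlinarith [norm_nonneg ε, norm_nonneg (deriv g z)]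
    linarith
  rw [norm_preSchwarzian_sub_eq hD hf hz (hfs.2 z hz) hε,
    inv_mul_le_iff₀ (hyperbolicDensity_pos hz hD'), mul_one]
  calc _ ≤ hyperbolicDensity D z * 1 := by
        gcongr
        · exact (hyperbolicDensity_pos hz hD').le
        · rwa [div_le_iff₀ hpos]
    _ = _ := mul_one _

end

/-! ### The estimates for the norms -/

lemma hyperbolicNorm_le_add_one {D : Set ℂ} {P Q : ℂ → ℂ}
    (hPQ : ∀ z ∈ D, (hyperbolicDensity D z)⁻¹ * ‖P z - Q z‖ ≤ 1)
    (hpos : ∀ z ∈ D, 0 < hyperbolicDensity D z) :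
    hyperbolicNorm D P ≤ hyperbolicNorm D Q + 1 := by
  refine iSup₂_le fun z hz => ?_
  have h0 : 0 ≤ (hyperbolicDensity D z)⁻¹ := (inv_pos.mpr (hpos z hz)).le
  have h1 : (hyperbolicDensity D z)⁻¹ * ‖P z‖ ≤ (hyperbolicDensity D z)⁻¹ * ‖Q z‖ + 1 := by
    calc (hyperbolicDensity D z)⁻¹ * ‖P z‖
        ≤ (hyperbolicDensity D z)⁻¹ * (‖Q z‖ + ‖P z - Q z‖) := by
          gcongr
          linarith [norm_sub_norm_le (P z) (Q z)]
      _ ≤ _ := by rw [mul_add]; linarith [hPQ z hz]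
  calc ENNReal.ofReal ((hyperbolicDensity D z)⁻¹ * ‖P z‖)
      ≤ ENNReal.ofReal ((hyperbolicDensity D z)⁻¹ * ‖Q z‖ + 1) := ENNReal.ofReal_le_ofReal h1
    _ = ENNReal.ofReal ((hyperbolicDensity D z)⁻¹ * ‖Q z‖) + 1 := by
        rw [ENNReal.ofReal_add (by positivity) zero_le_one, ENNReal.ofReal_one]
    _ ≤ hyperbolicNorm D Q + 1 := by
        gcongr
        exact le_iSup₂ (f := fun z _ => ENNReal.ofReal ((hyperbolicDensity D z)⁻¹ * ‖Q z‖)) z hz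

section

variable {D : Set ℂ} {f h g : ℂ → ℂ}

lemma hyperbolicNorm_shear_le (hD : IsOpen D) (hD' : ∃ φ, IsConformalDiskMap φ D)
    (hfs : IsSensePreservingHarmonic f D) (hf : IsAnalyticDecomposition f h g D) {ε : ℂ}
    (hε : ε ∈ closedBall (0 : ℂ) 1) :
    hyperbolicNorm D (preSchwarzian (shear h g ε)) ≤
      hyperbolicNorm D (harmonicPreSchwarzian f) + 1 :=
  hyperbolicNorm_le_add_one (fun _ hz => norm_preSchwarzian_sub_le hD hD' hfs hf hz
    (mem_closedBall_zero_iff.mp hε)) fun _ hz => hyperbolicDensity_pos hz hD'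

lemma hyperbolicNorm_harmonicPreSchwarzian_le (hD : IsOpen D)
    (hD' : ∃ φ, IsConformalDiskMap φ D) (hfs : IsSensePreservingHarmonic f D)
    (hf : IsAnalyticDecomposition f h g D) :
    hyperbolicNorm D (harmonicPreSchwarzian f) ≤
      (⨅ ε ∈ closedBall (0 : ℂ) 1, hyperbolicNorm D (preSchwarzian (shear h g ε))) + 1 := by
  simp only [ENNReal.iInf_add]
  refine le_iInf₂ fun ε hε => hyperbolicNorm_le_add_one (fun z hz => ?_)
    fun z hz => hyperbolicDensity_pos hz hD'
  rw [norm_sub_rev]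
  exact norm_preSchwarzian_sub_le hD hD' hfs hf hz (mem_closedBall_zero_iff.mp hε)

lemma max_iSup_sub_one_le (hD : IsOpen D) (hD' : ∃ φ, IsConformalDiskMap φ D)
    (hfs : IsSensePreservingHarmonic f D) (hf : IsAnalyticDecomposition f h g D) :
    max 0 ((⨆ ε ∈ closedBall (0 : ℂ) 1, hyperbolicNorm D (preSchwarzian (shear h g ε))) - 1) ≤
      hyperbolicNorm D (harmonicPreSchwarzian f) :=
  max_le zero_le (tsub_le_iff_right.mpr
    (iSup₂_le fun _ hε => hyperbolicNorm_shear_le hD hD' hfs hf hε))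

/-- The norm of the pre-Schwarzian of `h + ε g` is a supremum of continuous functions of `ε`, hence
lower semicontinuous on the closed disk, and attains its minimum. -/
lemma exists_hyperbolicNorm_shear_eq_iInf (hD : IsOpen D) (hfs : IsSensePreservingHarmonic f D)
    (hf : IsAnalyticDecomposition f h g D) :
    ∃ ε₀ ∈ closedBall (0 : ℂ) 1, hyperbolicNorm D (preSchwarzian (shear h g ε₀)) =
      ⨅ ε ∈ closedBall (0 : ℂ) 1, hyperbolicNorm D (preSchwarzian (shear h g ε)) := by
  have hlsc : LowerSemicontinuousOn
      (fun ε => hyperbolicNorm D (preSchwarzian (shear h g ε))) (closedBall 0 1) := by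
    refine lowerSemicontinuousOn_biSup fun z hz => ContinuousOn.lowerSemicontinuousOn ?_
    refine ENNReal.continuous_ofReal.comp_continuousOn
      (ContinuousOn.mul continuousOn_const (ContinuousOn.norm ?_))
    refine ContinuousOn.congr (f := fun ε =>
      (deriv (deriv h) z + ε * deriv (deriv g) z) / (deriv h z + ε * deriv g z)) ?_
      fun ε _ => preSchwarzian_shear hD hf.left hf.right ε hz
    exact ContinuousOn.div (by fun_prop) (by fun_prop) fun ε hε =>
      add_mul_ne_zero_of_norm_lt (norm_deriv_lt_of_jacobian_pos hD hf hz (hfs.2 z hz))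
        (mem_closedBall_zero_iff.mp hε)
  obtain ⟨ε₀, hε₀, hmin⟩ := hlsc.exists_isMinOn ⟨0, by simp⟩ (isCompact_closedBall (0 : ℂ) 1)
  exact ⟨ε₀, hε₀, le_antisymm (le_iInf₂ fun ε hε => hmin hε) (iInf₂_le ε₀ hε₀)⟩

end

/-! ### Sharpness -/

/-- For a conformal mapping `ψ` of `D` into the disk that is extremal in the Schwarz–Pick
inequality at `z`, the harmonic mapping `ψ + conj (ψ ^ 2 / 2)` has dilatation `ψ`. -/
lemma exists_norm_preSchwarzian_sub_eq_one {D : Set ℂ} (hD : IsOpen D)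
    (hD' : ∃ φ, IsConformalDiskMap φ D) {z : ℂ} (hz : z ∈ D) :
    ∃ f h g : ℂ → ℂ, IsSensePreservingHarmonic f D ∧ IsAnalyticDecomposition f h g D ∧
      ∃ ε ∈ closedBall (0 : ℂ) 1, (hyperbolicDensity D z)⁻¹ *
        ‖preSchwarzian (shear h g ε) z - harmonicPreSchwarzian f z‖ = 1 := by
  obtain ⟨ψ, hψ, hρ⟩ := exists_norm_deriv_eq hz hD'
  have hg : ∀ w ∈ D, HasDerivAt (fun w => ψ w ^ 2 / 2) (ψ w * deriv ψ w) w := fun w hw => by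
    refine (((hψ.hasDerivAt hD hw).fun_pow 2).div_const 2).congr_deriv ?_
    push_cast
    ring
  have hlt : ∀ w ∈ D, ‖deriv (fun w => ψ w ^ 2 / 2) w‖ < ‖deriv ψ w‖ := fun w hw => by
    rw [(hg w hw).deriv, norm_mul]
    exact mul_lt_of_lt_one_left (norm_pos_iff.mpr (hψ.deriv_ne_zero w hw)) (hψ.norm_lt_one hw)
  obtain ⟨hfs, hf⟩ := isSensePreservingHarmonic_of_norm_deriv_lt hD hψ.differentiableOn
    (fun w hw => (hg w hw).differentiableAt.differentiableWithinAt) hlt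
  refine ⟨_, _, _, hfs, hf, 1, by simp, ?_⟩
  have hω : ∀ w ∈ D, deriv (fun w => ψ w ^ 2 / 2) w / deriv ψ w = ψ w := fun w hw => by
    rw [(hg w hw).deriv, mul_div_cancel_right₀ _ (hψ.deriv_ne_zero w hw)]
  have hωd : deriv (fun w => deriv (fun w => ψ w ^ 2 / 2) w / deriv ψ w) z = deriv ψ z :=
    EventuallyEq.deriv_eq (by filter_upwards [hD.mem_nhds hz] with w hw using hω w hw)
  rw [norm_preSchwarzian_sub_eq hD hf hz (hfs.2 z hz) (by simp), hωd, hω z hz, hρ]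
  -- The last factor is `1` because `|ε| = 1`.
  have hs : 0 < ‖deriv ψ z + 1 * deriv (fun w => ψ w ^ 2 / 2) z‖ :=
    norm_pos_iff.mpr (add_mul_ne_zero_of_norm_lt (hlt z hz) (by simp))
  have hsq := norm_sq_add_mul_sub (deriv ψ z) (deriv (fun w => ψ w ^ 2 / 2) z) 1
  rw [norm_one, one_pow, sub_self, zero_mul, sub_eq_zero,
    sq_eq_sq₀ (norm_nonneg _) (norm_nonneg _)] at hsq
  have h1 : 1 - ‖ψ z‖ ^ 2 ≠ 0 := by nlinarith [norm_nonneg (ψ z), hψ.norm_lt_one hz]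
  have h2 := (hyperbolicDensity_pos hz hD').ne'
  rw [← hsq, div_self hs.ne']
  field_simp

/-- In a disk, with the normalized variable `u = (z - c) / r`, take `h = -log (1 - u)` and
`g = h - u`. Then `h - g = u` has vanishing pre-Schwarzian, while that of `h + g` is `2 / r` at the
centre, where the density is `1 / r`. This forces equality in both estimates. -/
lemma exists_hyperbolicNorm_eq (c : ℂ) {r : ℝ} (hr : 0 < r)
    (hD' : ∃ φ, IsConformalDiskMap φ (ball c r)) :
    ∃ f h g : ℂ → ℂ,
      IsSensePreservingHarmonic f (ball c r) ∧ IsAnalyticDecomposition f h g (ball c r) ∧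
      hyperbolicNorm (ball c r) (harmonicPreSchwarzian f) ≠ ⊤ ∧
      max 0 ((⨆ ε ∈ closedBall (0 : ℂ) 1,
          hyperbolicNorm (ball c r) (preSchwarzian (shear h g ε))) - 1)
        = hyperbolicNorm (ball c r) (harmonicPreSchwarzian f) ∧
      hyperbolicNorm (ball c r) (harmonicPreSchwarzian f)
        = (⨅ ε ∈ closedBall (0 : ℂ) 1,
          hyperbolicNorm (ball c r) (preSchwarzian (shear h g ε))) + 1 := by
  have hr0 : (r : ℂ) ≠ 0 := ofReal_ne_zero.mpr hr.ne'
  have hr1 : (r : ℂ)⁻¹ ≠ 0 := inv_ne_zero hr0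
  set u : ℂ → ℂ := fun z => (z - c) * (r : ℂ)⁻¹ with hu
  have hud : ∀ z, HasDerivAt u (r : ℂ)⁻¹ z := fun z => by
    simpa using ((hasDerivAt_id z).sub_const c).mul_const (r : ℂ)⁻¹
  have hu1 : ∀ z ∈ ball c r, ‖u z‖ < 1 := fun z hz => by
    rw [hu, norm_mul, norm_inv, norm_real, Real.norm_of_nonneg hr.le, ← div_eq_mul_inv,
      div_lt_one hr]
    exact mem_ball_iff_norm.mp hz
  have hslit : ∀ z ∈ ball c r, 1 - u z ∈ slitPlane := fun z hz => by
    left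
    have := (re_le_norm (u z)).trans_lt (hu1 z hz)
    simpa using this
  set h : ℂ → ℂ := fun z => -log (1 - u z)
  set g : ℂ → ℂ := fun z => h z - u z
  have hh : ∀ z ∈ ball c r, HasDerivAt h ((r : ℂ)⁻¹ / (1 - u z)) z := fun z hz => by
    refine (((hud z).const_sub 1).clog (hslit z hz)).neg.congr_deriv ?_
    rw [neg_div, neg_neg]
  have hg : ∀ z ∈ ball c r, HasDerivAt g ((r : ℂ)⁻¹ / (1 - u z) - (r : ℂ)⁻¹) z := fun z hz =>
    (hh z hz).sub (hud z)
  have hlt : ∀ z ∈ ball c r, ‖deriv g z‖ < ‖deriv h z‖ := fun z hz => by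
    have h0 := slitPlane_ne_zero (hslit z hz)
    have e : (r : ℂ)⁻¹ / (1 - u z) - (r : ℂ)⁻¹ = u z * ((r : ℂ)⁻¹ / (1 - u z)) := by
      field_simp
      ring
    rw [(hh z hz).deriv, (hg z hz).deriv, e, norm_mul]
    exact mul_lt_of_lt_one_left (norm_pos_iff.mpr (div_ne_zero hr1 h0)) (hu1 z hz)
  have hhd : DifferentiableOn ℂ h (ball c r) := fun z hz =>
    (hh z hz).differentiableAt.differentiableWithinAt
  have hgd : DifferentiableOn ℂ g (ball c r) := fun z hz =>
    (hg z hz).differentiableAt.differentiableWithinAt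
  obtain ⟨hfs, hf⟩ := isSensePreservingHarmonic_of_norm_deriv_lt isOpen_ball hhd hgd hlt
  have hinf : (⨅ ε ∈ closedBall (0 : ℂ) 1,
      hyperbolicNorm (ball c r) (preSchwarzian (shear h g ε))) = 0 := by
    refine le_antisymm ((iInf₂_le (-1) (by simp)).trans (iSup₂_le fun z _ => ?_)) zero_le
    have e : shear h g (-1) = u := by
      funext z
      simp only [shear, g]
      ring
    have hu' : deriv u = fun _ => (r : ℂ)⁻¹ := funext fun z => (hud z).deriv
    rw [e, preSchwarzian, hu']
    simp
  have hc : c ∈ ball c r := mem_ball_self hr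
  have huc : u c = 0 := by simp [hu]
  have hsup : 2 ≤ ⨆ ε ∈ closedBall (0 : ℂ) 1,
      hyperbolicNorm (ball c r) (preSchwarzian (shear h g ε)) := by
    refine le_trans ?_ (le_iSup₂ (f := fun ε _ =>
      hyperbolicNorm (ball c r) (preSchwarzian (shear h g ε))) 1 (by simp))
    refine le_trans ?_ (le_iSup₂ (f := fun z _ => ENNReal.ofReal
      ((hyperbolicDensity (ball c r) z)⁻¹ * ‖preSchwarzian (shear h g 1) z‖)) c hc)
    have hdd : HasDerivAt (deriv h) ((r : ℂ)⁻¹ * (r : ℂ)⁻¹) c := by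
      have h1 : HasDerivAt (fun z => (r : ℂ)⁻¹ / (1 - u z)) ((r : ℂ)⁻¹ * (r : ℂ)⁻¹) c := by
        refine ((hasDerivAt_const c (r : ℂ)⁻¹).fun_div ((hud c).const_sub 1)
          (slitPlane_ne_zero (hslit c hc))).congr_deriv ?_
        rw [huc]
        ring
      refine h1.congr_of_eventuallyEq ?_
      filter_upwards [isOpen_ball.mem_nhds hc] with z hz using (hh z hz).deriv
    have hgg : HasDerivAt (deriv g) ((r : ℂ)⁻¹ * (r : ℂ)⁻¹) c := by
      refine (hdd.sub_const (r : ℂ)⁻¹).congr_of_eventuallyEq ?_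
      filter_upwards [isOpen_ball.mem_nhds hc] with z hz
      rw [(hh z hz).deriv, (hg z hz).deriv]
    have hP : preSchwarzian (shear h g 1) c = 2 * (r : ℂ)⁻¹ := by
      rw [preSchwarzian_shear isOpen_ball hhd hgd 1 hc, hdd.deriv, hgg.deriv, (hh c hc).deriv,
        (hg c hc).deriv, huc]
      field_simp
      ring
    have hρ : r ≤ (hyperbolicDensity (ball c r) c)⁻¹ := by
      rw [le_inv_comm₀ hr (hyperbolicDensity_pos hc hD')]
      exact hyperbolicDensity_ball_center_le hr hD'
    rw [hP, norm_mul, norm_inv, norm_real, Real.norm_of_nonneg hr.le]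
    rw [show (2 : ℝ≥0∞) = ENNReal.ofReal 2 by simp]
    apply ENNReal.ofReal_le_ofReal
    calc (2 : ℝ) = r * (‖(2 : ℂ)‖ * r⁻¹) := by
          rw [show ‖(2 : ℂ)‖ = 2 by simp]
          field_simp
      _ ≤ _ := by gcongr
  have hle := hyperbolicNorm_harmonicPreSchwarzian_le isOpen_ball hD' hfs hf
  have hge := max_iSup_sub_one_le isOpen_ball hD' hfs hf
  have h1 : 1 ≤ max 0 ((⨆ ε ∈ closedBall (0 : ℂ) 1,
      hyperbolicNorm (ball c r) (preSchwarzian (shear h g ε))) - 1) := by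
    refine le_max_of_le_right ?_
    calc (1 : ℝ≥0∞) = 2 - 1 := by rw [← one_add_one_eq_two, ENNReal.add_sub_cancel_right (by simp)]
      _ ≤ _ := tsub_le_tsub_right hsup 1
  rw [hinf, zero_add] at hle
  refine ⟨_, h, g, hfs, hf, (hle.trans_lt ENNReal.one_lt_top).ne,
    le_antisymm hge (hle.trans h1), ?_⟩
  rw [hinf, zero_add]
  exact le_antisymm hle (h1.trans hge)

lemma isSimplyConnected_ball (c : ℂ) {r : ℝ} (hr : 0 < r) : IsSimplyConnected (ball c r) := by
  have := (convex_ball c r).contractibleSpace (nonempty_ball.mpr hr)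
  exact SimplyConnectedSpace.ofContractible _

end HarmonicMapping

theorem corollary3 :
    (∀ D : Set ℂ, IsOpen D → IsSimplyConnected D → D ≠ univ →
      -- the two estimates
      (∀ f h g : ℂ → ℂ, IsSensePreservingHarmonic f D → IsAnalyticDecomposition f h g D →
        (∀ ε ∈ closedBall (0 : ℂ) 1, ∀ z ∈ D,
          deriv (shear h g ε) z ≠ 0 ∧
          (hyperbolicDensity D z)⁻¹ *
            ‖preSchwarzian (shear h g ε) z - harmonicPreSchwarzian f z‖ ≤ 1) ∧
        max 0 ((⨆ ε ∈ closedBall (0 : ℂ) 1,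
            hyperbolicNorm D (preSchwarzian (shear h g ε))) - 1)
          ≤ hyperbolicNorm D (harmonicPreSchwarzian f) ∧
        hyperbolicNorm D (harmonicPreSchwarzian f)
          ≤ (⨅ ε ∈ closedBall (0 : ℂ) 1,
            hyperbolicNorm D (preSchwarzian (shear h g ε))) + 1 ∧
        -- the infimum is a minimum
        (∃ ε₀ ∈ closedBall (0 : ℂ) 1,
          hyperbolicNorm D (preSchwarzian (shear h g ε₀)) =
            ⨅ ε ∈ closedBall (0 : ℂ) 1, hyperbolicNorm D (preSchwarzian (shear h g ε)))) ∧
      -- sharpness of the first estimate, in every domain and at every point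
      (∀ z ∈ D, ∃ f h g : ℂ → ℂ,
        IsSensePreservingHarmonic f D ∧ IsAnalyticDecomposition f h g D ∧
        ∃ ε ∈ closedBall (0 : ℂ) 1,
          (hyperbolicDensity D z)⁻¹ *
            ‖preSchwarzian (shear h g ε) z - harmonicPreSchwarzian f z‖ = 1)) ∧
    -- sharpness of both sides of the second estimate, in every disk
    (∀ (c : ℂ) (r : ℝ), 0 < r → ∃ f h g : ℂ → ℂ,
      IsSensePreservingHarmonic f (ball c r) ∧ IsAnalyticDecomposition f h g (ball c r) ∧
      hyperbolicNorm (ball c r) (harmonicPreSchwarzian f) ≠ ⊤ ∧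
      max 0 ((⨆ ε ∈ closedBall (0 : ℂ) 1,
          hyperbolicNorm (ball c r) (preSchwarzian (shear h g ε))) - 1)
        = hyperbolicNorm (ball c r) (harmonicPreSchwarzian f) ∧
      hyperbolicNorm (ball c r) (harmonicPreSchwarzian f)
        = (⨅ ε ∈ closedBall (0 : ℂ) 1,
          hyperbolicNorm (ball c r) (preSchwarzian (shear h g ε))) + 1) := by
  refine ⟨fun D hD hsc hne => ?_, fun c r hr => ?_⟩
  · have hD' := HarmonicMapping.exists_isConformalDiskMap hD hsc hne
    refine ⟨fun f h g hfs hf => ⟨fun ε hε z hz => ?_,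
      HarmonicMapping.max_iSup_sub_one_le hD hD' hfs hf,
      HarmonicMapping.hyperbolicNorm_harmonicPreSchwarzian_le hD hD' hfs hf,
      HarmonicMapping.exists_hyperbolicNorm_shear_eq_iInf hD hfs hf⟩,
      fun z hz => HarmonicMapping.exists_norm_preSchwarzian_sub_eq_one hD hD' hz⟩
    have hε' := mem_closedBall_zero_iff.mp hε
    refine ⟨?_, HarmonicMapping.norm_preSchwarzian_sub_le hD hD' hfs hf hz hε'⟩
    rw [(HarmonicMapping.hasDerivAt_shear hD hf.left hf.right ε hz).deriv]
    exact HarmonicMapping.add_mul_ne_zero_of_norm_lt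
      (HarmonicMapping.norm_deriv_lt_of_jacobian_pos hD hf hz (hfs.2 z hz)) hε'
  · have hne : ball c r ≠ univ := fun h => NormedSpace.unbounded_univ ℝ ℂ (h ▸ isBounded_ball)
    exact HarmonicMapping.exists_hyperbolicNorm_eq c hr
      (HarmonicMapping.exists_isConformalDiskMap isOpen_ball
        (HarmonicMapping.isSimplyConnected_ball c hr) hne)
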